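/- Let $Q\subseteq\Sigma^*\times\mathbb N$ be a parameterized problem over a finite nonempty alphabet, and let algorithms be programs for a PRAM. The work of an algorithm on an input is the number of computational steps summed over all non-idle processors, and $W_{\mathsf A}(n,k)$ is the maximum work of $\mathsf A$ on inputs $(x,k)$ with $|x|=n$. Let $D$ be a set of nonempty vectors $d=(d_1,\dots,d_m)$ of positive integers (of possibly unbounded length). For $d\in D$ let $\xi_d$ be the reciprocal of the minimal positive root of $1-\sum_{i=1}^m z^{d_i}$, let $\xi_D=\sup_{d\in D}\xi_d\in[0,\infty]$, and assume $\xi_D>1$. A $D$-branching algorithm $\mathsf B$ for $Q$ is an algorithm that on every input $(x,k)$ either correctly outputs "$(x,k)\in Q$" or "$(x,k)\notin Q$", or outputs instances $(x_1,k-d_1),\dots,(x_m,k-d_m)$ with $(d_1,\dots,d_m)\in D$, $d_i\le k$ and $|x_i|\le|x|$, such that $(x,k)\in Q$ if and only if $(x_i,k-d_i)\in Q$ for some $i$. In the latter case write $d(x,k)=(d_1,\dots,d_m)$ and $|d(x,k)|=m$. A polynomial-size kernel algorithm $\mathsf K$ for $Q$ is an algorithm that maps every $(x,k)$ to some $(x',k')$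 with $(x,k)\in Q\iff(x',k')\in Q$, $k'\le k$ and $|x'|\le s(k)$ for a fixed polynomial $s$, and whose work on $(x,k)$ is bounded by a polynomial in $|x|+k$. Let $\mathsf{ParInterleave\text{-}B\text{-}K}$ be the parallel search tree algorithm that, on an instance, first applies $\mathsf K$, then applies $\mathsf B$ to the resulting kernel, and then processes all instances output by $\mathsf B$ recursively in parallel, accepting if and only if some call of $\mathsf B$ outputs "$\in Q$". Its work is the sum of the work of all calls of $\mathsf K$ and $\mathsf B$, plus, for each call of $\mathsf K$ or $\mathsf B$ that halts, one step and $|y|+2$ steps for every instance $(y,j)$ that it outputs (copying). Theorem. Let $\mathsf B$ be a $D$-branching algorithm for $Q$ such that (a) the work of $\mathsf B$ on every input $(x,k)$ is at most $|d(x,k)|\cdot|x|^{O(1)}$, respectively $|x|^{O(1)}$ when $\mathsf B$ outputs a verdict (read as $|d(x,k)|\cdot(|x|+2)^a$, respectively $(|x|+2)^a$, for a constant $a$); and (b) for some constants $\varepsilon>0$ and $c$, every entry of $d(x,k)$ is at most $(1-\varepsilon)k+c$ for all inputs $(x,k)$ on which $\mathsf B$ branches. Let $\mathsf K$ be a polynomial-size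 kernel algorithm for $Q$. Then $W_{\mathsf{ParInterleave\text{-}B\text{-}K}}(n,k)=O(W_{\mathsf K}(n,k)+\xi_D^k)$; that is, there is a constant $C$ such that for all $n,k\in\mathbb N$ $$W_{\mathsf{ParInterleave\text{-}B\text{-}K}}(n,k)\le C\cdot\bigl(W_{\mathsf K}(n,k)+\xi_D^k\bigr).$$ -/

import Mathlib

open scoped ENNReal

/-! ## Synchronous parallel machines, halting and work -/

/-- A synchronous parallel machine with inputs in `α` and outputs in `β`. `active c` is the number of
non-idle processors in configuration `c`; the machine has halted when it is zero. -/
structure Machine (α β : Type) where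
  Config : Type
  init : α → Config
  step : Config → Config
  active : Config → ℕ
  output : Config → β
  step_halted : ∀ c, active c = 0 → step c = c

namespace Machine

variable {α β : Type}

/-- The configuration after `t` steps on input `a`. -/
def configAt (M : Machine α β) (a : α) (t : ℕ) : M.Config := M.step^[t] (M.init a)

/-- On input `a`, the machine halts with output `b`. -/
def Computes (M : Machine α β) (a : α) (b : β) : Prop :=
  ∃ t, M.active (M.configAt a t) = 0 ∧ M.output (M.configAt a t) = b

/-- The work on input `a`: the number of computational steps, summed over all non-idle processors
(it is `∞` if the machine does not halt on `a`). -/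
noncomputable def work (M : Machine α β) (a : α) : ℝ≥0∞ :=
  ∑' t, (M.active (M.configAt a t) : ℝ≥0∞)

end Machine

/-! ## The parallel random access machine -/

namespace PRAM

/-- Instructions; `r`, `s`, `t` name local registers of the executing processor. -/
inductive Instr where
  /-- `r := c` -/
  | const (r c : ℕ)
  /-- `r :=` index of the executing processor -/
  | index (r : ℕ)
  /-- `r := s + t` -/
  | add (r s t : ℕ)
  /-- `r := max (s - t) 0` -/
  | sub (r s t : ℕ)
  /-- `r := ⌊s / 2⌋` -/
  | half (r s : ℕ)
  /-- `r :=` content of the shared memory cell whose address is in `s` -/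
  | load (r s : ℕ)
  /-- write `s` to the shared memory cell whose address is in `r` -/
  | store (r s : ℕ)
  /-- continue at line `l` -/
  | jump (l : ℕ)
  /-- continue at line `l` if `r = 0` -/
  | jzero (r l : ℕ)
  /-- activate a new processor, which gets a copy of the local registers and starts at line `l` -/
  | fork (l : ℕ)
  | halt

/-- A program, executed by all processors. Leaving the program means halting. -/
abbrev Program := List Instr

/-- The shared memory. -/
abbrev Memory := ℕ → ℕ

/-- The local state of a processor. -/
structure Proc where
  pc : ℕ
  reg : ℕ → ℕ
  running : Bool

/-- Shared memory together with all processors activated so far, in order of their index. -/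
structure Config where
  mem : Memory
  procs : List Proc

/-- The instruction that a processor is about to execute; idle processors execute none. -/
def fetch (P : Program) (p : Proc) : Option Instr :=
  if p.running then some (P.getD p.pc .halt) else none

/-- The local effect of one step on processor number `i`. -/
def localStep (P : Program) (m : Memory) (i : ℕ) (p : Proc) : Proc :=
  match fetch P p with
  | none => p
  | some (.const r c) => { p with pc := p.pc + 1, reg := Function.update p.reg r c }
  | some (.index r) => { p with pc := p.pc + 1, reg := Function.update p.reg r i }
  | some (.add r s t) =>
      { p with pc := p.pc + 1, reg := Function.update p.reg r (p.reg s + p.reg t) }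
  | some (.sub r s t) =>
      { p with pc := p.pc + 1, reg := Function.update p.reg r (p.reg s - p.reg t) }
  | some (.half r s) => { p with pc := p.pc + 1, reg := Function.update p.reg r (p.reg s / 2) }
  | some (.load r s) => { p with pc := p.pc + 1, reg := Function.update p.reg r (m (p.reg s)) }
  | some (.store _ _) => { p with pc := p.pc + 1 }
  | some (.jump l) => { p with pc := l }
  | some (.jzero r l) => { p with pc := if p.reg r = 0 then l else p.pc + 1 }
  | some (.fork _) => { p with pc := p.pc + 1 }
  | some .halt => { p with running := false }

/-- The write (address and value) that a processor performs in this step, if any. -/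
def write? (P : Program) (p : Proc) : Option (ℕ × ℕ) :=
  match fetch P p with
  | some (.store r s) => some (p.reg r, p.reg s)
  | _ => none

/-- The processor that a processor activates in this step, if any. -/
def spawn? (P : Program) (p : Proc) : Option Proc :=
  match fetch P p with
  | some (.fork l) => some { pc := l, reg := p.reg, running := true }
  | _ => none

/-- One synchronous step. All reads precede all writes; concurrent reads and writes are allowed, and
of several writes to the same cell the one by the processor of smallest index succeeds. -/
def step (P : Program) (c : Config) : Config where
  mem := c.procs.foldr
    (fun p m => match write? P p with
      | some (a, v) => Function.update m a v
      | none => m) c.mem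
  procs := c.procs.mapIdx (localStep P c.mem) ++ c.procs.filterMap (spawn? P)

/-- The number of non-idle processors. -/
def active (c : Config) : ℕ := c.procs.countP (fun p => p.running)

theorem step_halted (P : Program) (c : Config) (h : active c = 0) : step P c = c := by
  have hf : ∀ p ∈ c.procs, fetch P p = none := by
    intro p hp
    have h0 := (List.countP_eq_zero.mp h) p hp
    simp [fetch, h0]
  obtain ⟨m, l⟩ := c
  simp only at hf
  have h1 : l.foldr (fun p m => match write? P p with
      | some (a, v) => Function.update m a v
      | none => m) m = m := by
    clear h
    induction l with
    | nil => rfl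
    | cons p l ih =>
      rw [List.foldr_cons, ih (fun q hq => hf q (List.mem_cons_of_mem _ hq))]
      simp [write?, hf p List.mem_cons_self]
  have h2 : l.filterMap (spawn? P) = [] := by
    rw [List.filterMap_eq_nil_iff]
    intro p hp
    simp [spawn?, hf p hp]
  have h3 : l.mapIdx (localStep P m) = l := by
    apply List.ext_getElem (by simp)
    intro i hi hi'
    simp [localStep, hf _ (List.getElem_mem hi')]
  simp only [step, h1, h2, h3, List.append_nil]

/-- The machine that runs the program `P`: it starts with a single non-idle processor, all of whose
registers are zero, on the shared memory `enc a`; when it has halted, its output is read off the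
shared memory by `dec`. -/
def machine {α β : Type} (P : Program) (enc : α → Memory) (dec : Memory → β) : Machine α β where
  Config := Config
  init a := { mem := enc a, procs := [{ pc := 0, reg := fun _ => 0, running := true }] }
  step := step P
  active := active
  output c := dec c.mem
  step_halted := step_halted P

end PRAM

/-! ## Instances, kernel algorithms and branching algorithms -/

/-- Instances `(x, k)` over the alphabet `Fin σ`; the number `k` is the parameter. -/
abbrev Inst (σ : ℕ) := List (Fin σ) × ℕ

/-- Input convention: `k`, then the length of `x`, then the letters of `x`. -/
def encodeInst {σ : ℕ} (y : Inst σ) : PRAM.Memory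
  | 0 => y.2
  | 1 => y.1.length
  | c + 2 => (y.1.map Fin.val).getD c 0

/-- The instance stored at address `a`, in the same format. -/
def decodeInst {σ : ℕ} [NeZero σ] (a : ℕ) (m : PRAM.Memory) : Inst σ :=
  (List.ofFn fun j : Fin (m (a + 1)) => Fin.ofNat σ (m (a + 2 + j)), m a)

/-- What a branching algorithm may output: a verdict, or a sequence of new instances. -/
inductive Outcome (σ : ℕ) where
  | reject
  | accept
  | branch (l : List (Inst σ))

/-- Output convention of branching algorithms: cell `0` holds `0` for "not in `Q`", `1` for "in `Q`",
and any other number for branching; in the last case cell `1` holds the number of new instances and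
the cells from `2` on hold the addresses at which they are stored. -/
def decodeOutcome {σ : ℕ} [NeZero σ] (m : PRAM.Memory) : Outcome σ :=
  if m 0 = 0 then .reject
  else if m 0 = 1 then .accept
  else .branch (List.ofFn fun i : Fin (m 1) => decodeInst (m (2 + i)) m)

/-- A program, run as an algorithm that maps instances to instances. -/
def kernelMachine (σ : ℕ) [NeZero σ] (K : PRAM.Program) : Machine (Inst σ) (Inst σ) :=
  PRAM.machine K encodeInst (decodeInst 0)

/-- A program, run as a branching algorithm. -/
def branchMachine (σ : ℕ) [NeZero σ] (B : PRAM.Program) : Machine (Inst σ) (Outcome σ) :=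
  PRAM.machine B encodeInst decodeOutcome

/-- The branching vector `d = (k - k₁, …, k - kₘ)` of an outcome on an input with parameter `k`
(empty for a verdict). -/
def Outcome.vector {σ : ℕ} (k : ℕ) : Outcome σ → List ℕ
  | .reject => []
  | .accept => []
  | .branch l => l.map fun y => k - y.2

/-- `o` is a correct outcome of a `D`-branching algorithm for `Q` on input `(x, k)`. -/
def Outcome.Valid {σ : ℕ} (D : Set (List ℕ)) (Q : Set (Inst σ)) (x : List (Fin σ)) (k : ℕ) :
    Outcome σ → Prop
  | .reject => (x, k) ∉ Q
  | .accept => (x, k) ∈ Q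
  | .branch l =>
      (Outcome.branch l).vector k ∈ D ∧
      (∀ y ∈ l, y.2 < k ∧ y.1.length ≤ x.length) ∧
      ((x, k) ∈ Q ↔ ∃ y ∈ l, y ∈ Q)

/-- The program `B` is a `D`-branching algorithm for `Q`. -/
def IsBranchingAlgorithm {σ : ℕ} [NeZero σ] (D : Set (List ℕ)) (Q : Set (Inst σ))
    (B : PRAM.Program) : Prop :=
  ∀ x k, ∃ o, (branchMachine σ B).Computes (x, k) o ∧ o.Valid D Q x k

/-- The program `K` is a kernel algorithm for `Q` whose kernels have polynomial size: it does
polynomial work, preserves membership in `Q`, does not increase the parameter, and the size of its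
output is bounded by a polynomial in the parameter of its input. -/
def IsPolyKernelAlgorithm {σ : ℕ} [NeZero σ] (Q : Set (Inst σ)) (K : PRAM.Program) : Prop :=
  (∃ p : Polynomial ℕ, ∀ x k,
    (kernelMachine σ K).work (x, k) ≤ (p.eval (x.length + k) : ℕ)) ∧
  ∃ s : Polynomial ℕ, ∀ x k, ∃ x' k', (kernelMachine σ K).Computes (x, k) (x', k') ∧
    ((x, k) ∈ Q ↔ (x', k') ∈ Q) ∧ x'.length ≤ s.eval k ∧ k' ≤ k

/-! ## Branching numbers -/

/-- `ξ_d`: the reciprocal of the minimal positive root of `1 - ∑ᵢ z ^ dᵢ`. -/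
noncomputable def branchingNumber (d : List ℕ) : ℝ :=
  (sInf {z : ℝ | 0 < z ∧ 1 - (d.map fun e => z ^ e).sum = 0})⁻¹

/-- `ξ_D = sup_{d ∈ D} ξ_d`, which is `∞` if the `ξ_d` are unbounded. -/
noncomputable def supBranchingNumber (D : Set (List ℕ)) : ℝ≥0∞ :=
  ⨆ d ∈ D, ENNReal.ofReal (branchingNumber d)

/-! ## Parallel interleaving -/

namespace ParInterleave

variable {σ : ℕ} (K : Machine (Inst σ) (Inst σ)) (B : Machine (Inst σ) (Outcome σ))

/-- A recursive call that is currently being processed: it runs either the kernel algorithm on its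
instance or, later, the branching algorithm on the kernel. -/
inductive Call where
  | kernelize (c : K.Config)
  | branching (c : B.Config)

/-- The number of memory cells occupied by an instance. -/
def cells (y : Inst σ) : ℕ := y.1.length + 2

/-- The number of operations a call performs in the next step. A step in which the kernel algorithm or
the branching algorithm has already halted is used to hand over the resulting instance or
instances, and one operation per memory cell is charged for copying them. -/
def Call.active : Call K B → ℕ
  | .kernelize c => if K.active c = 0 then 1 + cells (K.output c) else K.active c
  | .branching c =>
      if B.active c = 0 then
        match B.output c with
        | .branch l => 1 + (l.map cells).sum
        | _ => 1
      else B.active c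

/-- The calls that continue a call after the next step. -/
def Call.next : Call K B → List (Call K B)
  | .kernelize c =>
      if K.active c = 0 then [.branching (B.init (K.output c))] else [.kernelize (K.step c)]
  | .branching c =>
      if B.active c = 0 then
        match B.output c with
        | .branch l => l.map fun y => .kernelize (K.init y)
        | _ => []
      else [.branching (B.step c)]

/-- Whether a call detects in the next step that it has found a "yes" instance. -/
def Call.accepts : Call K B → Bool
  | .kernelize _ => false
  | .branching c =>
      if B.active c = 0 then
        match B.output c with
        | .accept => true
        | _ => false
      else false

end ParInterleave

/-- The parallel search tree algorithm based on `B` that applies `K` at the beginning of each recursive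
call. All current calls are processed simultaneously; the answer is collected in a common flag that
every call may set. It has halted when no call is left. -/
def parInterleave {σ : ℕ} (B : Machine (Inst σ) (Outcome σ)) (K : Machine (Inst σ) (Inst σ)) :
    Machine (Inst σ) Bool where
  Config := Bool × List (ParInterleave.Call K B)
  init y := (false, [.kernelize (K.init y)])
  step c := (c.1 || c.2.any (ParInterleave.Call.accepts K B),
    c.2.flatMap (ParInterleave.Call.next K B))
  active c := (c.2.map (ParInterleave.Call.active K B)).sum
  output c := c.1
  step_halted := by
    rintro ⟨b, l⟩ h
    have hpos : ∀ a : ParInterleave.Call K B, 0 < ParInterleave.Call.active K B a := by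
      intro a
      cases a <;> simp only [ParInterleave.Call.active]
      · split_ifs <;> omega
      · split_ifs
        · split <;> omega
        · omega
    cases l with
    | nil => simp
    | cons a l =>
      have := hpos a
      simp only [List.map_cons, List.sum_cons] at h
      omega

/-- `W(n, k)`: the maximum work on inputs `(x, k)` with `|x| = n`. -/
noncomputable def maxWork {σ : ℕ} {β : Type} (M : Machine (Inst σ) β) (n k : ℕ) : ℝ≥0∞ :=
  ⨆ (x : List (Fin σ)) (_ : x.length = n), M.work (x, k)

/-! Only the first run of `K` sees an arbitrarily long input. Every other run starts from a kernel,
or from an instance no longer than one, so its work is polynomial in the parameter `k` of the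
surrounding call, up to a factor for the number of children. Charging the kernel work of each child
to its parent leaves the recurrence `f k ≤ ∑ (q k + f kᵢ)` with a polynomial `q`, where `∑ ξ ^ kᵢ ≤
ξ ^ k'` for the kernel parameter `k' ≤ k`. It is read off the machine by `work_eq_add` and
`workAfterKernel_eq`.

Without `q`, the function `ξ ^ k` would solve it. To absorb `q`, put `r = √ξ`. The bound on the
branching vectors gives `kᵢ ≥ ε k' - c`, so a polynomial overhead is `O(r ^ kᵢ)` when `k' = k`, and
the correction term in `C ξ ^ k - A r ^ k` pays for it (`sum_add_le_of_sum_pow_le`). When `k' < k`,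
the drop of the parameter itself pays (`length_mul_add_sum_le`). -/

/-! ## Work of machines and forests -/

namespace Machine

variable {α β : Type}

/-- The work done from configuration `c` on. -/
noncomputable def workFrom (M : Machine α β) (c : M.Config) : ℝ≥0∞ :=
  ∑' t, (M.active (M.step^[t] c) : ℝ≥0∞)

theorem workFrom_eq_add (M : Machine α β) (c : M.Config) :
    M.workFrom c = M.active c + M.workFrom (M.step c) := by
  unfold workFrom
  rw [tsum_eq_zero_add' ENNReal.summable]
  simp [Function.iterate_succ_apply]

theorem workFrom_of_halted (M : Machine α β) {c : M.Config} (h : M.active c = 0) :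
    M.workFrom c = 0 := by
  simp [workFrom, Function.iterate_fixed (M.step_halted c h), h]

end Machine

/-- The total cost of a forest that is explored level by level from the list `l` of its roots. -/
noncomputable def forestCost {α : Type} (next : α → List α) (cost : α → ℕ) (l : List α) : ℝ≥0∞ :=
  ∑' t : ℕ, ((((fun l : List α => l.flatMap next)^[t] l).map cost).sum : ℝ≥0∞)

section Forest

variable {α : Type} (next : α → List α) (cost : α → ℕ)

theorem iterate_flatMap_append (t : ℕ) (l₁ l₂ : List α) :
    (fun l : List α => l.flatMap next)^[t] (l₁ ++ l₂) =
      (fun l : List α => l.flatMap next)^[t] l₁ ++ (fun l : List α => l.flatMap next)^[t] l₂ := by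
  induction t generalizing l₁ l₂ with
  | zero => rfl
  | succ t ih => simp only [Function.iterate_succ_apply, List.flatMap_append, ih]

theorem forestCost_nil : forestCost next cost [] = 0 := by
  have h : ∀ t, (fun l : List α => l.flatMap next)^[t] [] = [] :=
    fun t => Function.iterate_fixed (by simp) t
  simp [forestCost, h]

theorem forestCost_append (l₁ l₂ : List α) :
    forestCost next cost (l₁ ++ l₂) = forestCost next cost l₁ + forestCost next cost l₂ := by
  unfold forestCost
  rw [← ENNReal.tsum_add]
  simp only [iterate_flatMap_append, List.map_append, List.sum_append, Nat.cast_add]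

theorem forestCost_eq_sum (l : List α) :
    forestCost next cost l = (l.map fun a => forestCost next cost [a]).sum := by
  induction l with
  | nil => simp [forestCost_nil]
  | cons a l ih =>
    rw [← List.singleton_append, forestCost_append, ih]
    simp

theorem forestCost_singleton (a : α) :
    forestCost next cost [a] = cost a + forestCost next cost (next a) := by
  unfold forestCost
  rw [tsum_eq_zero_add' ENNReal.summable]
  simp [Function.iterate_succ_apply]

end Forest

/-! ### Splitting the work into kernel runs, branching runs and subtrees. -/

namespace ParInterleave

variable {σ : ℕ} (K : Machine (Inst σ) (Inst σ)) (B : Machine (Inst σ) (Outcome σ))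

/-- The total number of operations performed by a list of calls and their descendants. -/
noncomputable def callWork (l : List (Call K B)) : ℝ≥0∞ :=
  forestCost (Call.next K B) (Call.active K B) l

/-- The accepting flag never influences the calls, so they evolve as a forest explored level by
level. -/
theorem configAt_snd (y : Inst σ) (t : ℕ) :
    ((parInterleave B K).configAt y t).2 =
      (fun l : List (Call K B) => l.flatMap (Call.next K B))^[t] [.kernelize (K.init y)] := by
  unfold Machine.configAt
  induction t with
  | zero => rfl
  | succ t ih =>
    rw [Function.iterate_succ_apply', Function.iterate_succ_apply', ← ih]
    rfl

theorem work_eq_callWork (y : Inst σ) :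
    (parInterleave B K).work y = callWork K B [.kernelize (K.init y)] := by
  unfold Machine.work callWork forestCost
  refine tsum_congr fun t => ?_
  rw [← configAt_snd]
  rfl

/-- The work of a call on `y`, apart from that of the kernel algorithm on `y`, when the kernel
is `y'`. -/
noncomputable def workAfterKernel (y' : Inst σ) : ℝ≥0∞ :=
  (1 + cells y' : ℕ) + callWork K B [.branching (B.init y')]

/-- Until `K` halts, the call has exactly one successor, so its forest begins with a path that
mirrors the run of `K`. -/
theorem callWork_kernelize_config (t : ℕ) (c : K.Config) (h : K.active (K.step^[t] c) = 0) :
    callWork K B [.kernelize c] =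
      K.workFrom c + workAfterKernel K B (K.output (K.step^[t] c)) := by
  induction t generalizing c with
  | zero =>
    have h0 : K.active c = 0 := h
    rw [K.workFrom_of_halted h0, zero_add, callWork, forestCost_singleton]
    simp only [Call.active, Call.next, h0, if_true]
    rfl
  | succ t ih =>
    rw [Function.iterate_succ_apply] at h ⊢
    -- `t` need not be the first halting time; a halted configuration is a fixed point.
    by_cases h0 : K.active c = 0
    · rw [K.step_halted c h0] at h ⊢
      exact ih c h
    · rw [K.workFrom_eq_add, add_assoc, ← ih _ h, callWork, forestCost_singleton]
      simp only [Call.active, Call.next, h0, if_false]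
      rfl

theorem work_eq_add {y y' : Inst σ} (h : K.Computes y y') :
    (parInterleave B K).work y = K.work y + workAfterKernel K B y' := by
  obtain ⟨t, ht, rfl⟩ := h
  rw [work_eq_callWork]
  exact callWork_kernelize_config K B t _ ht

/-- The work of handing over the outcome of the branching algorithm and of all resulting calls. -/
noncomputable def workAfterOutcome : Outcome σ → ℝ≥0∞
  | .branch l => (1 + (l.map cells).sum : ℕ) + (l.map (parInterleave B K).work).sum
  | _ => 1

theorem callWork_branching_config (t : ℕ) (c : B.Config) (h : B.active (B.step^[t] c) = 0) :
    callWork K B [.branching c] =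
      B.workFrom c + workAfterOutcome K B (B.output (B.step^[t] c)) := by
  induction t generalizing c with
  | zero =>
    have h0 : B.active c = 0 := h
    rw [B.workFrom_of_halted h0, zero_add, callWork, forestCost_singleton]
    simp only [Call.active, Call.next, h0, if_true, Function.iterate_zero, id]
    cases B.output c with
    | reject => simp [workAfterOutcome, forestCost_nil]
    | accept => simp [workAfterOutcome, forestCost_nil]
    | branch l =>
      simp only [workAfterOutcome]
      -- Each output instance roots a subtree that is a full run of the algorithm on it.
      rw [forestCost_eq_sum, List.map_map]
      congr 2
      refine List.map_congr_left fun y _ => ?_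
      rw [work_eq_callWork]
      rfl
  | succ t ih =>
    rw [Function.iterate_succ_apply] at h ⊢
    by_cases h0 : B.active c = 0
    · rw [B.step_halted c h0] at h ⊢
      exact ih c h
    · rw [B.workFrom_eq_add, add_assoc, ← ih _ h, callWork, forestCost_singleton]
      simp only [Call.active, Call.next, h0, if_false]
      rfl

theorem workAfterKernel_eq {y : Inst σ} {o : Outcome σ} (h : B.Computes y o) :
    workAfterKernel K B y =
      (1 + cells y : ℕ) + (B.work y + workAfterOutcome K B o) := by
  obtain ⟨t, ht, rfl⟩ := h
  rw [workAfterKernel, callWork_branching_config K B t _ ht]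
  rfl

end ParInterleave

/-! ## Branching numbers -/

theorem strictMonoOn_sum_pow {d : List ℕ} (hd : d ≠ []) (hpos : ∀ e ∈ d, 0 < e) :
    StrictMonoOn (fun z : ℝ => (d.map fun e => z ^ e).sum) (Set.Ici 0) := by
  intro x hx y _ hxy
  exact List.sum_lt_sum_of_ne_nil hd _ _
    fun e he => pow_lt_pow_left₀ hxy hx (hpos e he).ne'

/-- The reciprocal of the branching number is a root of the characteristic function. -/
theorem branchingNumber_pos_and_sum_eq_one {d : List ℕ} (hd : d ≠ []) (hpos : ∀ e ∈ d, 0 < e) :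
    0 < branchingNumber d ∧ (d.map fun e => (branchingNumber d)⁻¹ ^ e).sum = 1 := by
  have hmono := strictMonoOn_sum_pow hd hpos
  have hcont : Continuous fun z : ℝ => (d.map fun e => z ^ e).sum :=
    continuous_list_sum d fun e _ => continuous_pow e
  have h0 : (d.map fun e => (0 : ℝ) ^ e).sum = 0 := by
    refine List.sum_eq_zero fun x hx => ?_
    obtain ⟨e, he, rfl⟩ := List.mem_map.mp hx
    exact zero_pow (hpos e he).ne'
  have h1 : (1 : ℝ) ≤ (d.map fun e => (1 : ℝ) ^ e).sum := by
    simpa using Nat.one_le_iff_ne_zero.mpr (by simpa using hd)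
  obtain ⟨z, hz, hz1⟩ := intermediate_value_Icc zero_le_one hcont.continuousOn
    (show (1 : ℝ) ∈ Set.Icc _ _ from ⟨by simp only [h0, zero_le_one], h1⟩)
  have hz1 : (d.map fun e => z ^ e).sum = 1 := hz1
  have hz0 : 0 < z := by
    refine lt_of_le_of_ne hz.1 fun h => ?_
    rw [← h, h0] at hz1
    exact zero_ne_one hz1
  -- Strict monotonicity makes the positive root unique, so the infimum is attained.
  have hset : {z : ℝ | 0 < z ∧ 1 - (d.map fun e => z ^ e).sum = 0} = {z} := by
    ext w
    simp only [Set.mem_ofPred_eq, Set.mem_singleton_iff]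
    constructor
    · rintro ⟨hw, hw1⟩
      exact hmono.injOn hw.le hz0.le (by simp only [hz1]; linarith)
    · rintro rfl
      exact ⟨hz0, by rw [hz1, sub_self]⟩
  rw [branchingNumber, hset, csInf_singleton, inv_inv]
  exact ⟨inv_pos.mpr hz0, hz1⟩

theorem sum_inv_pow_le_one {d : List ℕ} (hd : d ≠ []) (hpos : ∀ e ∈ d, 0 < e) {x : ℝ}
    (hx : branchingNumber d ≤ x) : (d.map fun e => x⁻¹ ^ e).sum ≤ 1 := by
  obtain ⟨h0, h1⟩ := branchingNumber_pos_and_sum_eq_one hd hpos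
  rw [← h1]
  exact (strictMonoOn_sum_pow hd hpos).monotoneOn
    (inv_nonneg.mpr (h0.le.trans hx)) (inv_nonneg.mpr h0.le) (inv_anti₀ h0 hx)

theorem branchingNumber_le_toReal {D : Set (List ℕ)} (hfin : supBranchingNumber D ≠ ∞)
    {d : List ℕ} (hd : d ∈ D) : branchingNumber d ≤ (supBranchingNumber D).toReal :=
  (ENNReal.ofReal_le_iff_le_toReal hfin).mp
    (le_iSup₂ (f := fun d (_ : d ∈ D) => ENNReal.ofReal (branchingNumber d)) d hd)

/-! ## The recurrence -/

/-- Applied to the overhead with base `r ^ ε`. -/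
theorem Polynomial.exists_eval_le_mul_pow (q : Polynomial ℕ) {r : ℝ} (hr : 1 < r) :
    ∃ M : ℝ, 0 < M ∧ ∀ k : ℕ, ((q.eval k : ℕ) : ℝ) ≤ M * r ^ k := by
  have hr0 : 0 < r := zero_lt_one.trans hr
  induction q using Polynomial.induction_on' with
  | add p q hp hq =>
    obtain ⟨M, hM, hp⟩ := hp
    obtain ⟨N, hN, hq⟩ := hq
    refine ⟨M + N, add_pos hM hN, fun k => ?_⟩
    rw [Polynomial.eval_add, Nat.cast_add, add_mul]
    exact add_le_add (hp k) (hq k)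
  | monomial n a =>
    obtain ⟨M, hM, h⟩ := Asymptotics.bound_of_isBigO_nat_atTop
      (isLittleO_pow_const_const_pow_of_one_lt (R := ℝ) n hr).isBigO
    -- The factor `a + 1` keeps the constant positive when `a = 0`.
    refine ⟨(a + 1) * M, by positivity, fun k => ?_⟩
    have hk := h (pow_pos hr0 k).ne'
    rw [Real.norm_of_nonneg (by positivity), Real.norm_of_nonneg (by positivity)] at hk
    rw [Polynomial.eval_monomial]
    push_cast
    have ha : (0 : ℝ) ≤ a := a.cast_nonneg
    nlinarith [pow_pos hr0 k, mul_pos hM (pow_pos hr0 k)]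

/-- `C r²ᵏ - A rᵏ` solves the recurrence `f k = max ∑ (q + f jᵢ)`, where the `jᵢ < k` satisfy
`∑ r²ʲ ≤ r²ᵏ` and `q` grows at most like `r ^ jᵢ`. -/
theorem sum_add_le_of_sum_pow_le {r M A C q : ℝ} (hr : 1 < r) (hM : 0 ≤ M)
    (hA : M ≤ A * (1 - r⁻¹)) (hCA : A ≤ C) {k : ℕ} {l : List ℕ}
    (hlt : ∀ j ∈ l, j < k) (hsum : (l.map fun j => r ^ (2 * j)).sum ≤ r ^ (2 * k))
    (hq : ∀ j ∈ l, q ≤ M * r ^ j) :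
    (l.map fun j => q + (C * r ^ (2 * j) - A * r ^ j)).sum ≤ C * r ^ (2 * k) - A * r ^ k := by
  have hr0 : 0 < r := zero_lt_one.trans hr
  have hri : 0 < 1 - r⁻¹ := sub_pos.mpr (inv_lt_one_of_one_lt₀ hr)
  have hA0 : 0 ≤ A := nonneg_of_mul_nonneg_left (hM.trans hA) hri
  have hinv (i : ℕ) : r⁻¹ ^ i * r ^ i = 1 := by
    rw [← mul_pow, inv_mul_cancel₀ hr0.ne', one_pow]
  have hinv_le (i : ℕ) : r⁻¹ ^ i ≤ 1 :=
    pow_le_one₀ (by positivity) (inv_le_one_of_one_le₀ hr.le)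
  -- As `j < k`, the correction on the right is at most `A r ^ (j - 1)`; the remaining `A (1 - r⁻¹)
  -- r ^ j ≥ M r ^ j` pays for `q`. The coefficient on the right does not depend on `j`, so `hsum`
  -- applies.
  have hterm : ∀ j ∈ l, q + (C * r ^ (2 * j) - A * r ^ j) ≤
      (C - A * r⁻¹ ^ k) * r ^ (2 * j) := by
    intro j hj
    have h1 := hq j hj
    have h2 : r⁻¹ ^ k * r ^ (2 * j) ≤ r⁻¹ * r ^ j := by
      obtain ⟨e, rfl⟩ := Nat.exists_eq_add_of_lt (hlt j hj)
      have h3 : r⁻¹ ^ (j + e + 1) * r ^ (2 * j) = r⁻¹ ^ e * (r⁻¹ * r ^ j) := by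
        rw [two_mul, pow_add, pow_add, pow_add, pow_one]
        linear_combination (r⁻¹ ^ e * r⁻¹ * r ^ j) * hinv j
      rw [h3]
      exact mul_le_of_le_one_left (by positivity) (hinv_le e)
    have h4 := mul_le_mul_of_nonneg_left h2 hA0
    have h5 := mul_le_mul_of_nonneg_right hA (pow_pos hr0 j).le
    linarith
  refine (List.sum_le_sum hterm).trans ?_
  rw [List.sum_map_mul_left]
  have hA1 : A * r⁻¹ ^ k ≤ A := mul_le_of_le_one_right hA0 (hinv_le k)
  refine (mul_le_mul_of_nonneg_left hsum (by linarith)).trans (le_of_eq ?_)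
  rw [two_mul, pow_add]
  linear_combination (-A * r ^ k) * hinv k

/-- The recurrence of `sum_add_le_of_sum_pow_le` when the parameter first drops from `k` to `k'`. -/
theorem length_mul_add_sum_le {r M A C q : ℝ} (hr : 1 < r) (hM : 0 ≤ M)
    (hA : M ≤ A * (1 - r⁻¹)) (hC : M ≤ (C - A) * (1 - r⁻¹)) {k k' : ℕ} (hk : k' ≤ k) {l : List ℕ}
    (hlt : ∀ j ∈ l, j < k') (hsum : (l.map fun j => r ^ (2 * j)).sum ≤ r ^ (2 * k'))
    (hq : ∀ j ∈ l, q ≤ M * r ^ j * r ^ (k - k')) :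
    l.length * q + (l.map fun j => C * r ^ (2 * j) - A * r ^ j).sum ≤
      C * r ^ (2 * k) - A * r ^ k := by
  have hr0 : 0 < r := zero_lt_one.trans hr
  have hri : 0 < 1 - r⁻¹ := sub_pos.mpr (inv_lt_one_of_one_lt₀ hr)
  have hA0 : 0 ≤ A := nonneg_of_mul_nonneg_left (hM.trans hA) hri
  have hCA : 0 ≤ C - A := nonneg_of_mul_nonneg_left (hM.trans hC) hri
  have hlen : (l.length : ℝ) * q = (l.map fun _ => q).sum := by simp
  rw [hlen]
  rcases hk.eq_or_lt with rfl | hk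
  · rw [← List.sum_map_add]
    exact sum_add_le_of_sum_pow_le hr hM hA (sub_nonneg.mp hCA) hlt hsum
      fun j hj => by simpa using hq j hj
  -- The subtrees alone cost at most the bound at `k'`. The total overhead is at most `M r ^ (2k)`,
  -- which the growth of the bound from `k'` to `k` covers, being at least `(C - A) (1 - r⁻¹) r ^
  -- (2k)`.
  · have h1 := sum_add_le_of_sum_pow_le (q := 0) hr hM hA (sub_nonneg.mp hCA) hlt hsum
      fun j _ => by positivity
    simp only [zero_add] at h1
    obtain ⟨e, rfl⟩ := Nat.exists_eq_add_of_lt hk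
    have hle : ∀ {i i' : ℕ}, i ≤ i' → r ^ i ≤ r ^ i' := fun h => pow_le_pow_right₀ hr.le h
    have h2 : (l.map fun _ => q).sum ≤ M * r ^ (2 * (k' + e + 1)) := by
      have h3 : ∀ j ∈ l, q ≤ M * r ^ (2 * (e + 1)) * r ^ (2 * j) := by
        intro j hj
        refine (hq j hj).trans ?_
        rw [mul_assoc, mul_assoc, ← pow_add, ← pow_add]
        exact mul_le_mul_of_nonneg_left (hle (by omega)) hM
      refine (List.sum_le_sum h3).trans ?_
      rw [List.sum_map_mul_left]
      refine (mul_le_mul_of_nonneg_left hsum (by positivity)).trans (le_of_eq ?_)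
      rw [mul_assoc, ← pow_add]
      ring_nf
    have h4 : r ^ (2 * k') ≤ r⁻¹ * r ^ (2 * (k' + e + 1)) := by
      rw [show 2 * (k' + e + 1) = 2 * k' + 2 * e + 1 + 1 by ring, pow_succ', ← mul_assoc,
        inv_mul_cancel₀ hr0.ne', one_mul]
      exact hle (by omega)
    have h5 : r ^ (k' + e + 1) - r ^ k' ≤ r ^ (2 * (k' + e + 1)) - r ^ (2 * k') := by
      rw [pow_mul', pow_mul', sq_sub_sq, mul_comm]
      refine le_mul_of_one_le_right (sub_nonneg.mpr (hle (by omega))) ?_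
      have := one_le_pow₀ (n := k' + e + 1) hr.le
      have := one_le_pow₀ (n := k') hr.le
      linarith
    have h6 := mul_le_mul_of_nonneg_left h5 hA0
    have h7 := mul_le_mul_of_nonneg_left h4 hCA
    have h8 := mul_le_mul_of_nonneg_right hC (pow_pos hr0 (2 * (k' + e + 1))).le
    linarith

/-! ## The work of the parallel search tree algorithm -/

theorem Polynomial.eval_mono_nat (p : Polynomial ℕ) {m n : ℕ} (h : m ≤ n) :
    p.eval m ≤ p.eval n := by
  rw [Polynomial.eval_eq_sum, Polynomial.eval_eq_sum]
  exact Finset.sum_le_sum fun i _ => Nat.mul_le_mul_left _ (Nat.pow_le_pow_left h i)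

namespace ParInterleave

/-- An upper bound, for parameter `k`, for the work at one call per new instance, when kernels have
size `s k`, the kernel algorithm does work `p` and the branching algorithm work `(|x| + 2) ^ a`
per new instance. -/
noncomputable def overhead (p s : Polynomial ℕ) (a : ℕ) : Polynomial ℕ :=
  6 + 2 * s + (s + 2) ^ a + p.comp (s + Polynomial.X)

theorem overhead_eval (p s : Polynomial ℕ) (a k : ℕ) :
    (overhead p s a).eval k =
      6 + 2 * s.eval k + (s.eval k + 2) ^ a + p.eval (s.eval k + k) := by
  simp [overhead]

variable {σ : ℕ} {K : Machine (Inst σ) (Inst σ)} {B : Machine (Inst σ) (Outcome σ)}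

theorem workAfterKernel_le_of_verdict {p s : Polynomial ℕ} {a k : ℕ} {y : Inst σ} {o : Outcome σ}
    (hy : y.1.length ≤ s.eval k) (ho : B.Computes y o) (hv : o = .reject ∨ o = .accept)
    (hB : B.work y ≤ ((max 1 (o.vector y.2).length * (y.1.length + 2) ^ a : ℕ) : ℝ≥0∞)) :
    workAfterKernel K B y ≤ ((overhead p s a).eval k : ℕ) := by
  have hvec : o.vector y.2 = [] := by rcases hv with rfl | rfl <;> rfl
  have hout : workAfterOutcome K B o = (1 : ℕ) := by
    rcases hv with rfl | rfl <;> simp [workAfterOutcome]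
  have hpow := Nat.pow_le_pow_left (Nat.add_le_add_right hy 2) a
  rw [hvec] at hB
  rw [workAfterKernel_eq K B ho, hout]
  refine (add_le_add_right (add_le_add_left hB _) _).trans ?_
  norm_cast
  rw [overhead_eval]
  simp only [cells, List.length_nil, zero_le, sup_of_le_left, one_mul]
  omega

/-- The kernel runs of the children are charged here, where their inputs are known to be short; `g`
bounds only what follows those runs. -/
theorem workAfterKernel_le_of_branch {p s : Polynomial ℕ} {a k : ℕ} {y : Inst σ}
    {l : List (Inst σ)} {g : ℕ → ℝ≥0∞} (hne : l ≠ []) (hk : y.2 ≤ k)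
    (hy : y.1.length ≤ s.eval k) (ho : B.Computes y (.branch l))
    (hl : ∀ z ∈ l, z.2 < y.2 ∧ z.1.length ≤ y.1.length)
    (hB : B.work y ≤
      ((max 1 ((Outcome.branch l).vector y.2).length * (y.1.length + 2) ^ a : ℕ) : ℝ≥0∞))
    (hK : ∀ x k, K.work (x, k) ≤ (p.eval (x.length + k) : ℕ))
    (hg : ∀ z ∈ l, (parInterleave B K).work z ≤ K.work z + g z.2) :
    workAfterKernel K B y ≤
      (l.length * (overhead p s a).eval k : ℕ) + (l.map fun z => g z.2).sum := by
  have hpos : 1 ≤ l.length := List.length_pos_iff.mpr hne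
  have hlen : max 1 ((Outcome.branch l).vector y.2).length = l.length := by
    simpa [Outcome.vector] using hpos
  have hpow := Nat.pow_le_pow_left (Nat.add_le_add_right hy 2) a
  have hcells : (l.map cells).sum ≤ l.length * (s.eval k + 2) := by
    refine (List.sum_le_card_nsmul _ (s.eval k + 2) ?_).trans (by simp)
    intro n hn
    obtain ⟨z, hz, rfl⟩ := List.mem_map.mp hn
    exact Nat.add_le_add_right ((hl z hz).2.trans hy) 2
  have hrec : (l.map (parInterleave B K).work).sum ≤
      (l.length * p.eval (s.eval k + k) : ℕ) + (l.map fun z => g z.2).sum := by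
    have hz : ∀ z ∈ l, (parInterleave B K).work z ≤ (p.eval (s.eval k + k) : ℕ) + g z.2 := by
      intro z hz
      refine (hg z hz).trans (add_le_add_left ((hK z.1 z.2).trans ?_) _)
      exact Nat.cast_le.mpr (p.eval_mono_nat
        (Nat.add_le_add ((hl z hz).2.trans hy) ((hl z hz).1.le.trans hk)))
    refine (List.sum_le_sum hz).trans (le_of_eq ?_)
    rw [List.sum_map_add]
    simp
  rw [hlen] at hB
  rw [workAfterKernel_eq K B ho, workAfterOutcome]
  refine (add_le_add_right (add_le_add hB (add_le_add_right hrec _)) _).trans ?_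
  rw [← add_assoc, ← add_assoc, ← add_assoc]
  refine add_le_add_left ?_ _
  norm_cast
  rw [overhead_eval]
  simp only [cells]
  have h1 := Nat.mul_le_mul_left l.length hpow
  -- The cost `4 + s k` of handing over, incurred once, is charged to the children, of which there
  -- is at least one.
  have h2 := Nat.mul_le_mul hpos (le_refl (4 + s.eval k))
  nlinarith

end ParInterleave

theorem sum_ofReal_eq_ofReal_sum {α : Type*} (l : List α) {f : α → ℝ} (hf : ∀ a, 0 ≤ f a) :
    (l.map fun a => ENNReal.ofReal (f a)).sum = ENNReal.ofReal (l.map f).sum := by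
  induction l with
  | nil => simp
  | cons a l ih =>
    rw [List.map_cons, List.map_cons, List.sum_cons, List.sum_cons, ih,
      ENNReal.ofReal_add (hf a) (List.sum_nonneg fun x hx => ?_)]
    obtain ⟨b, -, rfl⟩ := List.mem_map.mp hx
    exact hf b

/-- A branching vector turns the parameter `k` into parameters `j` with `∑ x ^ j ≤ x ^ k`. -/
theorem sum_pow_le_pow {σ : ℕ} {D : Set (List ℕ)} (hD : ∀ d ∈ D, d ≠ [] ∧ ∀ e ∈ d, 0 < e)
    (hfin : supBranchingNumber D ≠ ∞) (hξ : 0 < (supBranchingNumber D).toReal)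
    {k : ℕ} {l : List (Inst σ)} (hl : ∀ z ∈ l, z.2 < k)
    (hd : (Outcome.branch l).vector k ∈ D) :
    (l.map fun z => (supBranchingNumber D).toReal ^ z.2).sum ≤
      (supBranchingNumber D).toReal ^ k := by
  have h := sum_inv_pow_le_one (hD _ hd).1 (hD _ hd).2 (branchingNumber_le_toReal hfin hd)
  set x := (supBranchingNumber D).toReal
  rw [Outcome.vector, List.map_map] at h
  have hz : ∀ z ∈ l, x ^ z.2 = x ^ k * x⁻¹ ^ (k - z.2) := by
    intro z hz
    rw [← Nat.sub_add_cancel (hl z hz).le, Nat.add_sub_cancel, pow_add, inv_pow]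
    field_simp
  rw [List.map_congr_left hz, List.sum_map_mul_left]
  exact mul_le_of_le_one_right (by positivity) h

/-- Apart from the first call of the kernel algorithm, the work is `O(ξ_D ^ k)`. -/
theorem exists_work_le_of_ne_top {σ : ℕ} {Q : Set (Inst σ)} {D : Set (List ℕ)}
    {K : Machine (Inst σ) (Inst σ)} {B : Machine (Inst σ) (Outcome σ)}
    (hD : ∀ d ∈ D, d ≠ [] ∧ ∀ e ∈ d, 0 < e)
    (hξ : 1 < supBranchingNumber D) (hfin : supBranchingNumber D ≠ ∞)
    (hB : ∀ x k, ∃ o, B.Computes (x, k) o ∧ o.Valid D Q x k) {a : ℕ}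
    (hBwork : ∀ (x : List (Fin σ)) (k : ℕ) (o : Outcome σ), B.Computes (x, k) o →
      B.work (x, k) ≤ ((max 1 (o.vector k).length * (x.length + 2) ^ a : ℕ) : ℝ≥0∞))
    {ε c : ℝ} (hε : 0 < ε)
    (hBvector : ∀ (x : List (Fin σ)) (k : ℕ) (o : Outcome σ), B.Computes (x, k) o →
      ∀ e ∈ o.vector k, (e : ℝ) ≤ (1 - ε) * k + c)
    {p s : Polynomial ℕ} (hp : ∀ x k, K.work (x, k) ≤ (p.eval (x.length + k) : ℕ))
    (hs : ∀ x k, ∃ x' k', K.Computes (x, k) (x', k') ∧ x'.length ≤ s.eval k ∧ k' ≤ k) :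
    ∃ C : ℕ, ∀ x k, (parInterleave B K).work (x, k) ≤
      K.work (x, k) + C * supBranchingNumber D ^ k := by
  -- With `ε ≤ 1` and `c ≥ 0`, `ε k ≤ k + c`, as verdicts need; `ε ≤ 1` also lets `r ^ (k - k')`
  -- cover a drop of the parameter.
  wlog hε1 : ε ≤ 1 generalizing ε
  · refine this (ε := 1) one_pos (fun x k o ho e he => (hBvector x k o ho e he).trans ?_) le_rfl
    have : (0 : ℝ) ≤ k := k.cast_nonneg
    nlinarith
  wlog hc : 0 ≤ c generalizing c
  · exact this (c := 0) (fun x k o ho e he => (hBvector x k o ho e he).trans (by linarith)) le_rfl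
  set ξ := (supBranchingNumber D).toReal with hξdef
  have hξ1 : 1 < ξ := by
    rwa [hξdef, ← ENNReal.toReal_one, ENNReal.toReal_lt_toReal ENNReal.one_ne_top hfin]
  set r := √ξ
  have hr : 1 < r := Real.lt_sqrt_of_sq_lt (by simpa using hξ1)
  have hr0 : 0 < r := zero_lt_one.trans hr
  have hrpow (k : ℕ) : r ^ (2 * k) = ξ ^ k := by
    rw [pow_mul, Real.sq_sqrt (by linarith)]
  obtain ⟨N, hN, hoverhead⟩ := (ParInterleave.overhead p s a).exists_eval_le_mul_pow
    (Real.one_lt_rpow hr hε)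
  set q : ℕ → ℕ := fun k => (ParInterleave.overhead p s a).eval k with hqdef
  have hq (k : ℕ) : (q k : ℝ) ≤ N * r ^ (ε * k) := by
    rw [Real.rpow_mul hr0.le, Real.rpow_natCast]
    exact hoverhead k
  set M := N * r ^ c
  have hM : 0 < M := by positivity
  have hqM {k k' j : ℕ} (hk : k' ≤ k) (hj : ε * k' ≤ j + c) :
      (q k : ℝ) ≤ M * r ^ j * r ^ (k - k') := by
    refine (hq k).trans ?_
    rw [mul_assoc, mul_assoc, ← Real.rpow_natCast, ← Real.rpow_natCast, ← Real.rpow_add hr0,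
      ← Real.rpow_add hr0, Nat.cast_sub hk]
    refine mul_le_mul_of_nonneg_left (Real.rpow_le_rpow_of_exponent_le hr.le ?_) hN.le
    have : (k' : ℝ) ≤ k := Nat.cast_le.mpr hk
    nlinarith
  have hri : 0 < 1 - r⁻¹ := sub_pos.mpr (inv_lt_one_of_one_lt₀ hr)
  -- This `A` gives equality in `hA`. With `C = 2 * A` the difference `C - A` is again `A`, so both
  -- conditions of `length_mul_add_sum_le` hold.
  set A := M / (1 - r⁻¹)
  have hA : M ≤ A * (1 - r⁻¹) := (div_mul_cancel₀ M hri.ne').ge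
  have hMA : M ≤ A := le_div_self hM.le hri (sub_le_self _ (by positivity))
  have hA0 : 0 < A := hM.trans_le hMA
  set g : ℕ → ℝ := fun k => 2 * A * r ^ (2 * k) - A * r ^ k with hg
  have hle (k : ℕ) : M * r ^ k ≤ g k := by
    have h1 : r ^ k ≤ r ^ (2 * k) := pow_le_pow_right₀ hr.le (by omega)
    have h2 := mul_le_mul_of_nonneg_right hMA (pow_pos hr0 k).le
    have h3 := mul_le_mul_of_nonneg_left h1 hA0.le
    simp only [hg]
    linarith
  have hg0 (k : ℕ) : 0 ≤ g k := (by positivity : 0 ≤ M * r ^ k).trans (hle k)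
  -- The first kernel run stays separate, since no function of `k` bounds it.
  have key : ∀ k x, (parInterleave B K).work (x, k) ≤ K.work (x, k) + ENNReal.ofReal (g k) := by
    intro k
    induction k using Nat.strong_induction_on with
    | _ k ih =>
    intro x
    obtain ⟨x', k', hcomp, hx', hk'⟩ := hs x k
    obtain ⟨o, ho, hvalid⟩ := hB x' k'
    rw [ParInterleave.work_eq_add K B hcomp]
    refine add_le_add_right ?_ _
    have hverdict (hv : o = .reject ∨ o = .accept) :
        ParInterleave.workAfterKernel K B (x', k') ≤ ENNReal.ofReal (g k) := by
      refine (ParInterleave.workAfterKernel_le_of_verdict (p := p) hx' ho hv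
        (hBwork x' k' o ho)).trans ?_
      rw [← ENNReal.ofReal_natCast]
      refine ENNReal.ofReal_le_ofReal (le_trans ?_ (hle k))
      have : (k : ℝ) * ε ≤ k := mul_le_of_le_one_right k.cast_nonneg hε1
      simpa using hqM (le_refl k) (j := k) (by linarith)
    cases o with
    | reject => exact hverdict (.inl rfl)
    | accept => exact hverdict (.inr rfl)
    | branch l =>
      obtain ⟨hd, hl, -⟩ := hvalid
      have hne : l ≠ [] := fun h => (hD _ hd).1 (by simp [h, Outcome.vector])
      refine (ParInterleave.workAfterKernel_le_of_branch (g := fun j => ENNReal.ofReal (g j))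
        hne hk' hx' ho hl (hBwork x' k' _ ho) hp
        fun z hz => ih z.2 ((hl z hz).1.trans_le hk') z.1).trans ?_
      have hg_sum : 0 ≤ (l.map fun z => g z.2).sum := by
        refine List.sum_nonneg fun x hx => ?_
        obtain ⟨z, -, rfl⟩ := List.mem_map.mp hx
        exact hg0 _
      rw [sum_ofReal_eq_ofReal_sum l fun z => hg0 z.2, ← ENNReal.ofReal_natCast, ← ENNReal.ofReal_add (Nat.cast_nonneg _) hg_sum]
      refine ENNReal.ofReal_le_ofReal ?_
      have hsum := sum_pow_le_pow hD hfin (by linarith) (fun z hz => (hl z hz).1) hd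
      have := length_mul_add_sum_le (C := 2 * A) (q := q k) (l := l.map Prod.snd) hr hM.le hA
        (by linarith) hk'
        (by
          intro j hj
          obtain ⟨z, hz, rfl⟩ := List.mem_map.mp hj
          exact (hl z hz).1)
        (by simpa only [List.map_map, Function.comp_def, hrpow] using hsum)
        (by
          intro j hj
          obtain ⟨z, hz, rfl⟩ := List.mem_map.mp hj
          refine hqM hk' ?_
          -- An entry `k' - j ≤ (1 - ε) k' + c` means `ε k' ≤ j + c`.
          have h1 := hBvector x' k' _ ho (k' - z.2) (List.mem_map_of_mem hz)
          rw [Nat.cast_sub (hl z hz).1.le] at h1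
          linarith)
      simpa only [List.length_map, List.map_map, Function.comp_def, Nat.cast_mul] using this
  refine ⟨⌈2 * A⌉₊, fun x k => (key k x).trans (add_le_add_right ?_ _)⟩
  rw [← ENNReal.ofReal_toReal hfin, ← hξdef, ← ENNReal.ofReal_natCast,
    ← ENNReal.ofReal_pow (by linarith), ← ENNReal.ofReal_mul (Nat.cast_nonneg _), ← hrpow]
  refine ENNReal.ofReal_le_ofReal ?_
  have h1 := mul_le_mul_of_nonneg_right (Nat.le_ceil (2 * A)) (pow_pos hr0 (2 * k)).le
  have h2 : 0 < A * r ^ k := by positivity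
  simp only [hg]
  linarith

/-- For parameter `0` there is no branching, so the work after the kernel algorithm is bounded. -/
theorem exists_work_le_of_param_zero {σ : ℕ} {Q : Set (Inst σ)} {D : Set (List ℕ)}
    {K : Machine (Inst σ) (Inst σ)} {B : Machine (Inst σ) (Outcome σ)}
    (hD : ∀ d ∈ D, d ≠ [])
    (hB : ∀ x k, ∃ o, B.Computes (x, k) o ∧ o.Valid D Q x k) {a : ℕ}
    (hBwork : ∀ (x : List (Fin σ)) (k : ℕ) (o : Outcome σ), B.Computes (x, k) o →
      B.work (x, k) ≤ ((max 1 (o.vector k).length * (x.length + 2) ^ a : ℕ) : ℝ≥0∞))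
    {s : Polynomial ℕ}
    (hs : ∀ x k, ∃ x' k', K.Computes (x, k) (x', k') ∧ x'.length ≤ s.eval k ∧ k' ≤ k) :
    ∃ C : ℕ, ∀ x, (parInterleave B K).work (x, 0) ≤ K.work (x, 0) + C := by
  -- No child exists, so the polynomial for the children's kernel work can be `0`.
  refine ⟨(ParInterleave.overhead 0 s a).eval 0, fun x => ?_⟩
  obtain ⟨x', k', hcomp, hx', hk'⟩ := hs x 0
  obtain rfl := Nat.le_zero.mp hk'
  obtain ⟨o, ho, hvalid⟩ := hB x' 0
  rw [ParInterleave.work_eq_add K B hcomp]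
  refine add_le_add_right (ParInterleave.workAfterKernel_le_of_verdict hx' ho ?_
    (hBwork x' 0 o ho)) _
  cases o with
  | reject => exact .inl rfl
  | accept => exact .inr rfl
  | branch l =>
    obtain ⟨hd, hl, -⟩ := hvalid
    cases l with
    | nil => exact absurd rfl (hD _ hd)
    | cons z l => exact absurd (hl z List.mem_cons_self).1 (Nat.not_lt_zero _)

theorem mainTheorem1 (σ : ℕ) [NeZero σ] (Q : Set (Inst σ)) (D : Set (List ℕ))
    (hD : ∀ d ∈ D, d ≠ [] ∧ ∀ e ∈ d, 0 < e)
    (hξ : 1 < supBranchingNumber D)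
    (B K : PRAM.Program)
    (hB : IsBranchingAlgorithm D Q B)
    (hBwork : ∃ a : ℕ, ∀ (x : List (Fin σ)) (k : ℕ) (o : Outcome σ),
      (branchMachine σ B).Computes (x, k) o →
      (branchMachine σ B).work (x, k) ≤
        ((max 1 (o.vector k).length * (x.length + 2) ^ a : ℕ) : ℝ≥0∞))
    (hBvector : ∃ ε : ℝ, 0 < ε ∧ ∃ c : ℝ, ∀ (x : List (Fin σ)) (k : ℕ) (o : Outcome σ),
      (branchMachine σ B).Computes (x, k) o →
      ∀ e ∈ o.vector k, (e : ℝ) ≤ (1 - ε) * k + c)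
    (hK : IsPolyKernelAlgorithm Q K) :
    ∃ C : ℕ, ∀ n k : ℕ,
      maxWork (parInterleave (branchMachine σ B) (kernelMachine σ K)) n k ≤
        C * (maxWork (kernelMachine σ K) n k + supBranchingNumber D ^ k) := by
  obtain ⟨a, hBwork⟩ := hBwork
  obtain ⟨ε, hε, c, hBvector⟩ := hBvector
  obtain ⟨⟨p, hp⟩, s, hs⟩ := hK
  have hs' : ∀ x k, ∃ x' k', (kernelMachine σ K).Computes (x, k) (x', k') ∧
      x'.length ≤ s.eval k ∧ k' ≤ k := by
    intro x k
    obtain ⟨x', k', hcomp, -, hx', hk'⟩ := hs x k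
    exact ⟨x', k', hcomp, hx', hk'⟩
  obtain ⟨C, hC⟩ : ∃ C : ℕ, ∀ x k,
      (parInterleave (branchMachine σ B) (kernelMachine σ K)).work (x, k) ≤
        (kernelMachine σ K).work (x, k) + C * supBranchingNumber D ^ k := by
    -- If `ξ_D = ∞`, the bound is trivial for `k > 0`, but `∞ ^ 0 = 1`, so `k = 0` needs an
    -- argument. The constant `C + 1` avoids `0 * ∞ = 0`.
    by_cases hfin : supBranchingNumber D = ∞
    · obtain ⟨C, hC⟩ := exists_work_le_of_param_zero (fun d hd => (hD d hd).1) hB hBwork hs'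
      refine ⟨C + 1, fun x k => ?_⟩
      rcases eq_or_ne k 0 with rfl | hk
      · refine (hC x).trans (add_le_add_right ?_ _)
        simp
      · simp [hfin, hk]
    · exact exists_work_le_of_ne_top hD hξ hfin hB hBwork hε hBvector hp hs'
  refine ⟨C + 1, fun n k => iSup₂_le fun x hx => (hC x k).trans ?_⟩
  rw [mul_add]
  refine add_le_add (le_trans ?_ (le_mul_of_one_le_left (zero_le) (by simp))) ?_
  · exact le_iSup₂ (f := fun (x : List (Fin σ)) (_ : x.length = n) =>
      (kernelMachine σ K).work (x, k)) x hx
  · gcongr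
    simp
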